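/- Let $M^n \hookrightarrow \mathbb{R}^{n+1}$ be a smooth embedded hypersurface with smooth unit normal field $N$ and induced metric $g$. Let $S(X) = -\bar\nabla_X N$ be its shape operator ($\bar\nabla$ the flat connection of $\mathbb{R}^{n+1}$), $H = \frac1n \operatorname{tr} S$ its mean curvature, and let $\Delta_B^{(n)} = g^{jk}\nabla_j\nabla_k$ and $\mathrm{Ric}^{(n)}$ be the Bochner Laplacian on vector fields and the Ricci curvature of $(M,g)$. Let $U$ be a vector field of class $C^2$ on an open set of $\mathbb{R}^{n+1}$ containing $M$ which is tangential to $M$ at the points of $M$, and let $\Delta_B^{(n+1)}$ be the Bochner Laplacian of flat $\mathbb{R}^{n+1}$ on vector fields. For any local coordinates $x = (x^1,\dots,x^n)$ on $M$, with corresponding points $p(x) \in M$, the map $(r,x) \mapsto p(x) + r N(p(x))$ is a local diffeomorphism near every point with $r = 0$, which gives Fermi coordinates $(r,x^1,\dots,x^n)$ near $M$; write $V^i$ for the tangential components of a vector field $V$ in these coordinates. The $U^i$ are of class $C^2$ near $r=0$, and for $i = 1,\dots,n$, with summation over repeated indices, $$(\Delta_B^{(n+1)}U)^i\big|_{r=0}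 = \Delta_B^{(n)}U^i + \big[nH\,S^i{}_l - (S^2)^i{}_l\big]U^l + \mathcal{F}_{\mathrm{rad}}^i, \qquad \mathcal{F}_{\mathrm{rad}}^i = \partial_r^2U^i - (nH\,\delta^i{}_j + 2S^i{}_j)\,\partial_rU^j ,$$ where everything on the right is evaluated at $r=0$. Moreover $nH\,S^i{}_l - (S^2)^i{}_l = \mathrm{Ric}^{(n)\,i}{}_l$, and therefore $$(\Delta_B^{(n+1)}U)^i\big|_{r=0} = \underbrace{\Delta_B^{(n)}U^i + \mathrm{Ric}^{(n)\,i}{}_l\,U^l}_{\Delta_{\mathrm{Def}}^{(n)}U^i} + \mathcal{F}_{\mathrm{rad}}^i .$$ -/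

import Mathlib

open scoped Manifold ContDiff

noncomputable section

namespace Hypersurface

/-! ### Riemannian geometry of a metric `g` in local coordinates

`g x` is the matrix `g_{ij}(x)` of the metric in coordinates `x = (x¹, …, xⁿ)`; a vector field
`Y = Yⁱ ∂_i` is given by its components `Y x i = Yⁱ(x)`. -/

/-- The partial derivative `∂_k f`. -/
def pd {n : ℕ} {F : Type*} [NormedAddCommGroup F] [NormedSpace ℝ F] (k : Fin n)
    (f : EuclideanSpace ℝ (Fin n) → F) (x : EuclideanSpace ℝ (Fin n)) : F :=
  fderiv ℝ f x (EuclideanSpace.single k 1)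

/-- Christoffel symbols of the Levi-Civita connection of `g`:
`Γⁱ_{jk} = ½ g^{il} (∂_j g_{lk} + ∂_k g_{lj} - ∂_l g_{jk})`. -/
def christoffel {n : ℕ} (g : EuclideanSpace ℝ (Fin n) → Matrix (Fin n) (Fin n) ℝ)
    (i j k : Fin n) (x : EuclideanSpace ℝ (Fin n)) : ℝ :=
  (1 / 2) * ∑ l, (g x)⁻¹ i l *
    (pd j (fun y => g y l k) x + pd k (fun y => g y l j) x - pd l (fun y => g y j k) x)

/-- First covariant derivative `∇_k Yⁱ = ∂_k Yⁱ + Γⁱ_{kl} Yˡ`. -/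
def covDeriv {n : ℕ} (g : EuclideanSpace ℝ (Fin n) → Matrix (Fin n) (Fin n) ℝ)
    (Y : EuclideanSpace ℝ (Fin n) → EuclideanSpace ℝ (Fin n))
    (k i : Fin n) (x : EuclideanSpace ℝ (Fin n)) : ℝ :=
  pd k (fun y => Y y i) x + ∑ l, christoffel g i k l x * Y x l

/-- Second covariant derivative
`∇_j ∇_k Yⁱ = ∂_j (∇_k Yⁱ) + Γⁱ_{jl} ∇_k Yˡ - Γˡ_{jk} ∇_l Yⁱ`. -/
def covDeriv₂ {n : ℕ} (g : EuclideanSpace ℝ (Fin n) → Matrix (Fin n) (Fin n) ℝ)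
    (Y : EuclideanSpace ℝ (Fin n) → EuclideanSpace ℝ (Fin n))
    (j k i : Fin n) (x : EuclideanSpace ℝ (Fin n)) : ℝ :=
  pd j (covDeriv g Y k i) x
    + ∑ l, christoffel g i j l x * covDeriv g Y k l x
    - ∑ l, christoffel g l j k x * covDeriv g Y l i x

/-- Bochner Laplacian of the metric `g` on vector fields: `(Δ_B Y)ⁱ = g^{jk} ∇_j ∇_k Yⁱ`. -/
def bochner {n : ℕ} (g : EuclideanSpace ℝ (Fin n) → Matrix (Fin n) (Fin n) ℝ)
    (Y : EuclideanSpace ℝ (Fin n) → EuclideanSpace ℝ (Fin n))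
    (x : EuclideanSpace ℝ (Fin n)) (i : Fin n) : ℝ :=
  ∑ j, ∑ k, (g x)⁻¹ j k * covDeriv₂ g Y j k i x

/-- Riemann curvature tensor `Rˡ_{kij}`, the `l`-th component of
`∇_i ∇_j ∂_k - ∇_j ∇_i ∂_k`. -/
def riemann {n : ℕ} (g : EuclideanSpace ℝ (Fin n) → Matrix (Fin n) (Fin n) ℝ)
    (l k i j : Fin n) (x : EuclideanSpace ℝ (Fin n)) : ℝ :=
  pd i (christoffel g l j k) x - pd j (christoffel g l i k) x
    + ∑ m, (christoffel g l i m x * christoffel g m j k x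
      - christoffel g l j m x * christoffel g m i k x)

/-- Ricci tensor `Ric_{kj} = Rⁱ_{kij}` (positive on round spheres). -/
def ricci {n : ℕ} (g : EuclideanSpace ℝ (Fin n) → Matrix (Fin n) (Fin n) ℝ)
    (x : EuclideanSpace ℝ (Fin n)) : Matrix (Fin n) (Fin n) ℝ :=
  Matrix.of fun k j => ∑ i, riemann g i k i j x

/-- Ricci tensor as an endomorphism, `Ricⁱ_l = g^{ij} Ric_{jl}`. -/
def ricciEnd {n : ℕ} (g : EuclideanSpace ℝ (Fin n) → Matrix (Fin n) (Fin n) ℝ)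
    (x : EuclideanSpace ℝ (Fin n)) : Matrix (Fin n) (Fin n) ℝ :=
  (g x)⁻¹ * ricci g x

/-- Deformation Laplacian `(Δ_Def Y)ⁱ = (Δ_B Y)ⁱ + Ricⁱ_l Yˡ`. -/
def deformationLaplacian {n : ℕ} (g : EuclideanSpace ℝ (Fin n) → Matrix (Fin n) (Fin n) ℝ)
    (Y : EuclideanSpace ℝ (Fin n) → EuclideanSpace ℝ (Fin n))
    (x : EuclideanSpace ℝ (Fin n)) (i : Fin n) : ℝ :=
  bochner g Y x i + ∑ l, ricciEnd g x i l * Y x l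

/-! ### The flat ambient space -/

/-- The flat connection of Euclidean space, `(∇̄_X V)(p) = DV(p)[X(p)]`. -/
def flatConn {m : ℕ} (X V : EuclideanSpace ℝ (Fin m) → EuclideanSpace ℝ (Fin m)) :
    EuclideanSpace ℝ (Fin m) → EuclideanSpace ℝ (Fin m) :=
  fun p => fderiv ℝ V p (X p)

/-- Bochner Laplacian of Euclidean space on vector fields: the trace of
`∇̄²_{X,Y} V = ∇̄_X ∇̄_Y V - ∇̄_{∇̄_X Y} V` over the standard orthonormal frame. -/
def ambientBochner {m : ℕ} (V : EuclideanSpace ℝ (Fin m) → EuclideanSpace ℝ (Fin m)) :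
    EuclideanSpace ℝ (Fin m) → EuclideanSpace ℝ (Fin m) :=
  fun p => ∑ a : Fin m,
    (flatConn (fun _ => EuclideanSpace.single a 1)
        (flatConn (fun _ => EuclideanSpace.single a 1) V) p
      - flatConn (flatConn (fun _ => EuclideanSpace.single a 1)
          (fun _ => EuclideanSpace.single a 1)) V p)

/-! ### Hypersurfaces

`f : M → ℝⁿ⁺¹` is the embedding, `N` the unit normal field along it and `e` a chart of `M`,
that is, a system of local coordinates `(x¹, …, xⁿ)`. -/

section

variable {n : ℕ} {M : Type*} [TopologicalSpace M]

/-- `N` is a smooth field of unit normals along `f : M → ℝⁿ⁺¹`. -/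
structure IsUnitNormal [ChartedSpace (EuclideanSpace ℝ (Fin n)) M]
    (f N : M → EuclideanSpace ℝ (Fin (n + 1))) : Prop where
  contMDiff : ContMDiff (𝓡 n) (𝓡 (n + 1)) ∞ N
  norm_eq_one : ∀ p, ‖N p‖ = 1
  orthogonal : ∀ (p : M) (v : TangentSpace (𝓡 n) p),
    inner ℝ (N p) (mfderiv (𝓡 n) (𝓡 (n + 1)) f p v : EuclideanSpace ℝ (Fin (n + 1))) = 0

/-- Induced metric in the coordinates `e`: `g_{ij} = ⟨∂_i f, ∂_j f⟩`. -/
def inducedMetric (f : M → EuclideanSpace ℝ (Fin (n + 1)))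
    (e : OpenPartialHomeomorph M (EuclideanSpace ℝ (Fin n)))
    (x : EuclideanSpace ℝ (Fin n)) : Matrix (Fin n) (Fin n) ℝ :=
  Matrix.of fun i j => inner ℝ (pd i (f ∘ e.symm) x) (pd j (f ∘ e.symm) x)

/-- Second fundamental form of the shape operator `S X = -∇̄_X N`:
`II_{jk} = ⟨S ∂_j, ∂_k⟩ = ⟨-∂_j N, ∂_k f⟩`. -/
def secondFundamentalForm (f N : M → EuclideanSpace ℝ (Fin (n + 1)))
    (e : OpenPartialHomeomorph M (EuclideanSpace ℝ (Fin n)))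
    (x : EuclideanSpace ℝ (Fin n)) : Matrix (Fin n) (Fin n) ℝ :=
  Matrix.of fun j k => inner ℝ (-pd j (N ∘ e.symm) x) (pd k (f ∘ e.symm) x)

/-- Matrix `Sⁱ_j` of the shape operator `S X = -∇̄_X N`, that is `S ∂_j = Sⁱ_j ∂_i` with
`Sⁱ_j = g^{ik} ⟨S ∂_j, ∂_k⟩`. -/
def shapeOperator (f N : M → EuclideanSpace ℝ (Fin (n + 1)))
    (e : OpenPartialHomeomorph M (EuclideanSpace ℝ (Fin n)))
    (x : EuclideanSpace ℝ (Fin n)) : Matrix (Fin n) (Fin n) ℝ :=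
  Matrix.of fun i j => ∑ k, (inducedMetric f e x)⁻¹ i k * secondFundamentalForm f N e x j k

/-- Mean curvature, the normalised trace `H = (1/n) tr S`. -/
def meanCurvature (f N : M → EuclideanSpace ℝ (Fin (n + 1)))
    (e : OpenPartialHomeomorph M (EuclideanSpace ℝ (Fin n)))
    (x : EuclideanSpace ℝ (Fin n)) : ℝ :=
  (1 / (n : ℝ)) * (shapeOperator f N e x).trace

/-- The map `(r, x) ↦ f(x) + r N(x)` defining Fermi coordinates. -/
def fermiMap (f N : M → EuclideanSpace ℝ (Fin (n + 1)))
    (e : OpenPartialHomeomorph M (EuclideanSpace ℝ (Fin n))) :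
    ℝ × EuclideanSpace ℝ (Fin n) → EuclideanSpace ℝ (Fin (n + 1)) :=
  fun q => f (e.symm q.2) + q.1 • N (e.symm q.2)

/-- A vector field `V` on the ambient space in Fermi coordinates: at `(r, x)` it is the pair
`(Vʳ, (V¹, …, Vⁿ))` with `V = Vʳ ∂_r + Vⁱ ∂_i`. -/
def inFermi (f N : M → EuclideanSpace ℝ (Fin (n + 1)))
    (e : OpenPartialHomeomorph M (EuclideanSpace ℝ (Fin n)))
    (V : EuclideanSpace ℝ (Fin (n + 1)) → EuclideanSpace ℝ (Fin (n + 1))) :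
    ℝ × EuclideanSpace ℝ (Fin n) → ℝ × EuclideanSpace ℝ (Fin n) :=
  VectorField.pullback ℝ (fermiMap f N e) V

/-- The `i`-th tangential component `Vⁱ(r, x)` of `V` in Fermi coordinates. -/
def fermiComp (f N : M → EuclideanSpace ℝ (Fin (n + 1)))
    (e : OpenPartialHomeomorph M (EuclideanSpace ℝ (Fin n)))
    (V : EuclideanSpace ℝ (Fin (n + 1)) → EuclideanSpace ℝ (Fin (n + 1)))
    (i : Fin n) (r : ℝ) (x : EuclideanSpace ℝ (Fin n)) : ℝ :=
  (inFermi f N e V (r, x)).2 i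

/-- The tangential part `x ↦ Vⁱ(0, x) ∂_i` of `V` along `M`, in the coordinates `e`. -/
def tangentialPart (f N : M → EuclideanSpace ℝ (Fin (n + 1)))
    (e : OpenPartialHomeomorph M (EuclideanSpace ℝ (Fin n)))
    (V : EuclideanSpace ℝ (Fin (n + 1)) → EuclideanSpace ℝ (Fin (n + 1))) :
    EuclideanSpace ℝ (Fin n) → EuclideanSpace ℝ (Fin n) :=
  fun x => (inFermi f N e V (0, x)).2

/-- Radial term `F_radⁱ = ∂_r² Uⁱ - (n H δⁱ_j + 2 Sⁱ_j) ∂_r Uʲ` at `r = 0`. -/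
def radialTerm (f N : M → EuclideanSpace ℝ (Fin (n + 1)))
    (e : OpenPartialHomeomorph M (EuclideanSpace ℝ (Fin n)))
    (U : EuclideanSpace ℝ (Fin (n + 1)) → EuclideanSpace ℝ (Fin (n + 1)))
    (x : EuclideanSpace ℝ (Fin n)) (i : Fin n) : ℝ :=
  iteratedDeriv 2 (fun r => fermiComp f N e U i r x) 0
    - ∑ j, (((n : ℝ) * meanCurvature f N e x) • (1 : Matrix (Fin n) (Fin n) ℝ)
        + (2 : ℝ) • shapeOperator f N e x) i j * deriv (fun r => fermiComp f N e U j r x) 0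

end

end Hypersurface

end

/-! ### Immersed hypersurfaces read in a chart. -/

namespace Hypersurface

variable {n : ℕ} {M : Type*} [TopologicalSpace M]

/-! The flat Laplacian is the trace of the ordinary second derivative D²U (`ambientBochner_eq`), so
it can be evaluated in the frame N, ∂_1 f, …, ∂_n f (`sum_basis_eq`) and its i-th component read off
with the dual coframe θⁱ (`coframe`). Since θⁱ(∂_l f) = δⁱ_l and θⁱ(N) = 0, the derivative ∂_j θⁱ
takes the values -Γⁱ_{jl} on ∂_l f and Sⁱ_j on N. This is `pd_coframe_apply`, from which the
intrinsic calculus on M follows.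

Tangential directions: applied to U ∘ f and its derivatives, that formula expresses ∇_j∇_k U through
ambient derivatives. With ∂_j∂_k f = Γˡ_{jk} ∂_l f + II_{jk} N, the trace becomes g^{jk} θⁱ(D²U(∂_j
f, ∂_k f)) = (Δ_B U)ⁱ - tr S · θⁱ(DU(N)) - (S²U)ⁱ.

Normal direction: the Fermi frame at height r is N, ∂_j f + r ∂_j N, so along the normal line θ(U) =
(1 - rS) applied to the Fermi components (`coframe_fermiMap`). Differentiating at r = 0 gives
θ(DU(N)) = ∂_r U - SU and θ(D²U(N,N)) = ∂_r²U - 2S ∂_r U (`coframe_fderiv_normal`).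

Adding the two contributions, with tr S = nH, gives the decomposition. The Gauss equation
`riemann_eq` comes from the same derivative formula applied to ∂_b∂_k f, and its contraction
identifies nH S - S² with Ricci. -/

/-- The hypersurface seen in one chart `e`: the parametrisation `f ∘ e.symm` and the unit normal
`N ∘ e.symm` are smooth, and the parametrisation is an immersion orthogonal to the normal. -/
structure IsRegularChart (f N : M → EuclideanSpace ℝ (Fin (n + 1)))
    (e : OpenPartialHomeomorph M (EuclideanSpace ℝ (Fin n))) : Prop where
  contDiffAt_param : ∀ y ∈ e.target, ContDiffAt ℝ ∞ (f ∘ e.symm) y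
  contDiffAt_normal : ∀ y ∈ e.target, ContDiffAt ℝ ∞ (N ∘ e.symm) y
  injective : ∀ y ∈ e.target, Function.Injective (fderiv ℝ (f ∘ e.symm) y)
  norm_eq_one : ∀ y, ‖(N ∘ e.symm) y‖ = 1
  orthogonal : ∀ y ∈ e.target, ∀ v,
    inner ℝ ((N ∘ e.symm) y) (fderiv ℝ (f ∘ e.symm) y v) = 0

/-- An immersion has a smooth local left inverse: in its normal form z ↦ (z, 0), project to the
first factor, then change coordinates to `e`. The chain rule then gives the derivative a left
inverse. -/
theorem _root_.Manifold.IsImmersionAt.injective_fderiv_comp_symm {m : ℕ}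
    [ChartedSpace (EuclideanSpace ℝ (Fin n)) M] [IsManifold (𝓡 n) ∞ M]
    {f : M → EuclideanSpace ℝ (Fin m)}
    {e : OpenPartialHomeomorph M (EuclideanSpace ℝ (Fin n))}
    (he : e ∈ IsManifold.maximalAtlas (𝓡 n) ∞ M)
    {y : EuclideanSpace ℝ (Fin n)} (hy : y ∈ e.target)
    (h : Manifold.IsImmersionAt (𝓡 n) (𝓡 m) ∞ f (e.symm y))
    (hd : DifferentiableAt ℝ (f ∘ e.symm) y) :
    Function.Injective (fderiv ℝ (f ∘ e.symm) y) := by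
  have hmem := h.mem_domChart_source
  have hφ : ContMDiffAt (𝓡 n) (𝓡 n) ∞ (e ∘ h.domChart.symm) (h.domChart (e.symm y)) := by
    refine ContMDiffAt.comp (I' := 𝓡 n) _ ?_ ?_
    · rw [h.domChart.left_inv hmem]
      exact contMDiffAt_of_mem_maximalAtlas he (e.map_target hy)
    · exact contMDiffAt_symm_of_mem_maximalAtlas h.domChart_mem_maximalAtlas
        (h.domChart.map_source hmem)
  have hψ : ContMDiffAt (𝓡 m) (𝓡 m) ∞ h.codChart (f (e.symm y)) :=
    contMDiffAt_of_mem_maximalAtlas h.codChart_mem_maximalAtlas h.mem_codChart_source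
  let L := (ContinuousLinearMap.fst ℝ (EuclideanSpace ℝ (Fin n)) h.complement).comp
    (h.equiv.symm : EuclideanSpace ℝ (Fin m) →L[ℝ] _)
  have key : ∀ z ∈ h.domChart.source, L (h.codChart (f z)) = h.domChart z := by
    intro z hz
    have := h.writtenInCharts
      (show h.domChart z ∈ (h.domChart.extend (𝓡 n)).target by simpa using h.domChart.map_source hz)
    simp [h.domChart.left_inv hz] at this
    simp [L, this]
  have hLψ : DifferentiableAt ℝ (fun w => L (h.codChart w)) (f (e.symm y)) :=
    L.differentiableAt.comp _ (hψ.contDiffAt.differentiableAt (by simp))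
  have hG : DifferentiableAt ℝ ((e ∘ h.domChart.symm) ∘ fun w => L (h.codChart w))
      ((f ∘ e.symm) y) := by
    refine DifferentiableAt.comp _ ?_ hLψ
    have := hφ.contDiffAt.differentiableAt (by simp)
    rwa [← key _ hmem] at this
  have hid : (((e ∘ h.domChart.symm) ∘ fun w => L (h.codChart w)) ∘ (f ∘ e.symm)) =ᶠ[nhds y] id := by
    have h1 : ∀ᶠ z in nhds y, e.symm z ∈ h.domChart.source :=
      (e.continuousAt_symm hy).eventually (h.domChart.open_source.mem_nhds hmem)
    filter_upwards [h1, e.open_target.mem_nhds hy] with z hz hzt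
    simp [key _ hz, h.domChart.left_inv hz, e.right_inv hzt]
  have := hid.fderiv_eq (𝕜 := ℝ)
  rw [fderiv_comp _ hG hd, fderiv_id] at this
  intro v w hvw
  have h2 := fun v => congrArg (fun A => A v) this
  simp only [ContinuousLinearMap.comp_apply] at h2
  have := (h2 v).symm.trans ((congrArg _ hvw).trans (h2 w))
  simpa using this

theorem isRegularChart [ChartedSpace (EuclideanSpace ℝ (Fin n)) M] [IsManifold (𝓡 n) ∞ M]
    {f N : M → EuclideanSpace ℝ (Fin (n + 1))}
    (hf : Manifold.IsSmoothEmbedding (𝓡 n) (𝓡 (n + 1)) ∞ f) (hN : IsUnitNormal f N)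
    {e : OpenPartialHomeomorph M (EuclideanSpace ℝ (Fin n))}
    (he : e ∈ IsManifold.maximalAtlas (𝓡 n) ∞ M) : IsRegularChart f N e := by
  have hs : ∀ y ∈ e.target, ContMDiffAt (𝓡 n) (𝓡 n) ∞ e.symm y := fun y hy =>
    contMDiffAt_symm_of_mem_maximalAtlas he hy
  have hp : ∀ y ∈ e.target, ContDiffAt ℝ ∞ (f ∘ e.symm) y := fun y hy =>
    (ContMDiffAt.comp y hf.contMDiff.contMDiffAt (hs y hy)).contDiffAt
  refine ⟨hp, fun y hy => (ContMDiffAt.comp y hN.contMDiff.contMDiffAt (hs y hy)).contDiffAt,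
    fun y hy => ?_, fun y => hN.norm_eq_one _, fun y hy v => ?_⟩
  · exact (hf.isImmersion.isImmersionAt _).injective_fderiv_comp_symm he hy
      ((hp y hy).differentiableAt (by simp))
  · have h1 : mfderiv (𝓡 n) (𝓡 (n + 1)) (f ∘ e.symm) y =
        (mfderiv (𝓡 n) (𝓡 (n + 1)) f (e.symm y)).comp (mfderiv (𝓡 n) (𝓡 n) e.symm y) :=
      mfderiv_comp y (hf.contMDiff.mdifferentiableAt (by simp))
        ((hs y hy).mdifferentiableAt (by simp))
    rw [mfderiv_eq_fderiv] at h1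
    rw [h1]
    exact hN.orthogonal _ _

end Hypersurface

/-! ### The frame (N, ∂_i f), its dual coframe, and traces. -/

namespace Hypersurface

variable {n : ℕ} {M : Type*} [TopologicalSpace M]
  {f N : M → EuclideanSpace ℝ (Fin (n + 1))}
  {e : OpenPartialHomeomorph M (EuclideanSpace ℝ (Fin n))}
  {y : EuclideanSpace ℝ (Fin n)}

/-- The tangential coordinate functionals along the hypersurface: `coframe f N e i y w` is the
component `wⁱ` of an ambient vector `w` at the point with coordinates `y`. -/
noncomputable def coframe (f N : M → EuclideanSpace ℝ (Fin (n + 1)))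
    (e : OpenPartialHomeomorph M (EuclideanSpace ℝ (Fin n))) (i : Fin n)
    (y : EuclideanSpace ℝ (Fin n)) : EuclideanSpace ℝ (Fin (n + 1)) →L[ℝ] ℝ :=
  ((EuclideanSpace.proj i).comp (ContinuousLinearMap.snd ℝ ℝ (EuclideanSpace ℝ (Fin n)))).comp
    (fderiv ℝ (fermiMap f N e) (0, y)).inverse

theorem fermiComp_zero (V : EuclideanSpace ℝ (Fin (n + 1)) → EuclideanSpace ℝ (Fin (n + 1)))
    (i : Fin n) (y : EuclideanSpace ℝ (Fin n)) :
    fermiComp f N e V i 0 y = coframe f N e i y (V ((f ∘ e.symm) y)) := by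
  simp [fermiComp, coframe, inFermi, VectorField.pullback, fermiMap]

theorem tangentialPart_apply
    (V : EuclideanSpace ℝ (Fin (n + 1)) → EuclideanSpace ℝ (Fin (n + 1)))
    (y : EuclideanSpace ℝ (Fin n)) (i : Fin n) :
    tangentialPart f N e V y i = coframe f N e i y (V ((f ∘ e.symm) y)) :=
  fermiComp_zero V i y

/-- A vector is the sum of its coordinates times the coordinate vectors. -/
theorem clm_apply_eq_sum {F : Type*} [NormedAddCommGroup F] [NormedSpace ℝ F]
    (A : EuclideanSpace ℝ (Fin n) →L[ℝ] F) (v : EuclideanSpace ℝ (Fin n)) :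
    A v = ∑ i, v i • A (EuclideanSpace.single i 1) := by
  conv_lhs => rw [← (EuclideanSpace.basisFun (Fin n) ℝ).sum_repr v]
  simp [map_sum]

namespace IsRegularChart

theorem contDiffAt_fermiMap (h : IsRegularChart f N e) (hy : y ∈ e.target) (r : ℝ) :
    ContDiffAt ℝ ∞ (fermiMap f N e) (r, y) := by
  have h1 : ContDiffAt ℝ ∞ (fun q : ℝ × EuclideanSpace ℝ (Fin n) => (f ∘ e.symm) q.2) (r, y) :=
    ContDiffAt.comp (g := f ∘ e.symm) (r, y) (h.contDiffAt_param y hy) contDiffAt_snd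
  have h2 : ContDiffAt ℝ ∞ (fun q : ℝ × EuclideanSpace ℝ (Fin n) => (N ∘ e.symm) q.2) (r, y) :=
    ContDiffAt.comp (g := N ∘ e.symm) (r, y) (h.contDiffAt_normal y hy) contDiffAt_snd
  exact h1.add (contDiffAt_fst.smul h2)

theorem fderiv_fermiMap (h : IsRegularChart f N e) (hy : y ∈ e.target) (r : ℝ)
    (q : ℝ × EuclideanSpace ℝ (Fin n)) :
    fderiv ℝ (fermiMap f N e) (r, y) q = q.1 • (N ∘ e.symm) y
      + (fderiv ℝ (f ∘ e.symm) y q.2 + r • fderiv ℝ (N ∘ e.symm) y q.2) := by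
  have h1 : HasFDerivAt (fun q : ℝ × EuclideanSpace ℝ (Fin n) => (f ∘ e.symm) q.2) _ (r, y) :=
    HasFDerivAt.comp (g := f ∘ e.symm) (r, y)
      ((h.contDiffAt_param y hy).differentiableAt (by simp)).hasFDerivAt hasFDerivAt_snd
  have h2 : HasFDerivAt (fun q : ℝ × EuclideanSpace ℝ (Fin n) => (N ∘ e.symm) q.2) _ (r, y) :=
    HasFDerivAt.comp (g := N ∘ e.symm) (r, y)
      ((h.contDiffAt_normal y hy).differentiableAt (by simp)).hasFDerivAt hasFDerivAt_snd
  have h3 : HasFDerivAt (fermiMap f N e) _ (r, y) := h1.add (hasFDerivAt_fst.smul h2)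
  rw [h3.fderiv]
  simp
  abel

/-- At r = 0 the differential is (s, v) ↦ sN + Df(v). Pairing with N isolates s, the immersion
property then kills v, and the dimensions agree. -/
theorem isInvertible (h : IsRegularChart f N e) (hy : y ∈ e.target) :
    (fderiv ℝ (fermiMap f N e) (0, y)).IsInvertible := by
  have hinj : Function.Injective (fderiv ℝ (fermiMap f N e) (0, y)) := by
    rw [injective_iff_map_eq_zero]
    rintro ⟨s, v⟩ hsv
    rw [h.fderiv_fermiMap hy] at hsv
    simp only [zero_smul, add_zero] at hsv
    have hs : s = 0 := by
      have := congrArg (inner ℝ ((N ∘ e.symm) y)) hsv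
      rw [inner_add_right, h.orthogonal y hy, inner_smul_right, real_inner_self_eq_norm_sq,
        h.norm_eq_one] at this
      simpa using this
    subst hs
    have : v = 0 := h.injective y hy (by simpa using hsv)
    rw [this, Prod.mk_zero_zero]
  have hfin : Module.finrank ℝ (ℝ × EuclideanSpace ℝ (Fin n))
      = Module.finrank ℝ (EuclideanSpace ℝ (Fin (n + 1))) := by
    simp [add_comm]
  refine ⟨(LinearEquiv.ofInjectiveOfFinrankEq
    (fderiv ℝ (fermiMap f N e) (0, y)).toLinearMap hinj hfin).toContinuousLinearEquiv, ?_⟩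
  exact ContinuousLinearMap.ext fun q => rfl

theorem eventually_isInvertible (h : IsRegularChart f N e) (hy : y ∈ e.target) :
    ∀ᶠ q in nhds ((0 : ℝ), y), (fderiv ℝ (fermiMap f N e) q).IsInvertible := by
  obtain ⟨A, hA⟩ := h.isInvertible hy
  have hc : ContinuousAt (fderiv ℝ (fermiMap f N e)) (0, y) :=
    ((h.contDiffAt_fermiMap hy 0).fderiv_right (m := 0) (by simp)).continuousAt
  have := A.nhds
  rw [hA] at this
  exact hc.eventually this

theorem contDiffAt_inFermi (h : IsRegularChart f N e) (hy : y ∈ e.target)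
    {U : EuclideanSpace ℝ (Fin (n + 1)) → EuclideanSpace ℝ (Fin (n + 1))}
    (hU : ContDiffAt ℝ 2 U ((f ∘ e.symm) y)) :
    ContDiffAt ℝ 2 (inFermi f N e U) (0, y) := by
  have hΦ := (h.contDiffAt_fermiMap hy 0)
  have h1 : ContDiffAt ℝ 2 (fun q => (fderiv ℝ (fermiMap f N e) q).inverse) (0, y) :=
    ContDiffAt.comp (0, y) (h.isInvertible hy).contDiffAt_map_inverse
      ((hΦ.fderiv_right (m := ∞) (by simp)).of_le (WithTop.coe_le_coe.2 le_top))
  have h2 : ContDiffAt ℝ 2 (fun q => U (fermiMap f N e q)) (0, y) :=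
    ContDiffAt.comp (0, y) (by simpa [fermiMap] using hU) (hΦ.of_le (WithTop.coe_le_coe.2 le_top))
  exact h1.clm_apply h2

theorem contDiffAt_coframe (h : IsRegularChart f N e) (hy : y ∈ e.target) (i : Fin n) :
    ContDiffAt ℝ ∞ (coframe f N e i) y := by
  have h0 : ContDiffAt ℝ ∞ (fun q => (fderiv ℝ (fermiMap f N e) q).inverse) (0, y) :=
    ContDiffAt.comp (0, y) (h.isInvertible hy).contDiffAt_map_inverse
      ((h.contDiffAt_fermiMap hy 0).fderiv_right (m := ∞) (by simp))
  have h1 : ContDiffAt ℝ ∞ (fun y => (fderiv ℝ (fermiMap f N e) (0, y)).inverse) y :=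
    ContDiffAt.comp y h0 (contDiffAt_const.prodMk contDiffAt_id)
  exact contDiffAt_const.clm_comp h1

theorem coframe_normal (h : IsRegularChart f N e) (hy : y ∈ e.target) (i : Fin n) :
    coframe f N e i y ((N ∘ e.symm) y) = 0 := by
  have := (h.isInvertible hy).inverse_apply_self (1, 0)
  rw [h.fderiv_fermiMap hy] at this
  simp only [one_smul, map_zero, smul_zero, add_zero] at this
  simp only [coframe, ContinuousLinearMap.comp_apply, this]
  simp

theorem coframe_param (h : IsRegularChart f N e) (hy : y ∈ e.target) (i j : Fin n) :
    coframe f N e i y (pd j (f ∘ e.symm) y) = (1 : Matrix (Fin n) (Fin n) ℝ) i j := by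
  have := (h.isInvertible hy).inverse_apply_self (0, EuclideanSpace.single j 1)
  rw [h.fderiv_fermiMap hy] at this
  simp only [zero_smul, zero_add, add_zero] at this
  simp only [coframe, ContinuousLinearMap.comp_apply, pd, this]
  simp [Matrix.one_apply]

theorem inner_normal_param (h : IsRegularChart f N e) (hy : y ∈ e.target) (i : Fin n) :
    inner ℝ ((N ∘ e.symm) y) (pd i (f ∘ e.symm) y) = 0 :=
  h.orthogonal y hy _

theorem inner_normal_normal (h : IsRegularChart f N e) (y : EuclideanSpace ℝ (Fin n)) :
    inner ℝ ((N ∘ e.symm) y) ((N ∘ e.symm) y) = (1 : ℝ) := by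
  rw [real_inner_self_eq_norm_sq, h.norm_eq_one, one_pow]

theorem decompose (h : IsRegularChart f N e) (hy : y ∈ e.target)
    (w : EuclideanSpace ℝ (Fin (n + 1))) :
    w = ∑ l, coframe f N e l y w • pd l (f ∘ e.symm) y
      + (inner ℝ ((N ∘ e.symm) y) w : ℝ) • (N ∘ e.symm) y := by
  have h1 := (h.isInvertible hy).self_apply_inverse w
  rw [h.fderiv_fermiMap hy, zero_smul, add_zero] at h1
  have h2 : ((fderiv ℝ (fermiMap f N e) (0, y)).inverse w).1 = inner ℝ ((N ∘ e.symm) y) w := by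
    have h3 := congrArg (inner ℝ ((N ∘ e.symm) y)) h1
    rw [inner_add_right, inner_smul_right, h.inner_normal_normal, h.orthogonal y hy] at h3
    simpa using h3
  rw [h2, clm_apply_eq_sum] at h1
  exact h1.symm.trans (add_comm _ _)

/-- The Riesz vector of θⁱ is tangential because θⁱ(N) = 0, so it is a combination of the ∂_l f.
This raises indices without a separate proof that the Gram matrix is invertible. -/
theorem inverse_inducedMetric (h : IsRegularChart f N e) (hy : y ∈ e.target) (i : Fin n) :
    (InnerProductSpace.toDual ℝ _).symm (coframe f N e i y)
      = ∑ l, (inducedMetric f e y)⁻¹ i l • pd l (f ∘ e.symm) y := by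
  set a := fun i => (InnerProductSpace.toDual ℝ (EuclideanSpace ℝ (Fin (n + 1)))).symm
    (coframe f N e i y) with ha
  have hinner : ∀ i w, inner ℝ (a i) w = coframe f N e i y w := fun i w =>
    InnerProductSpace.toDual_symm_apply
  have hdec : ∀ i, a i = ∑ l, coframe f N e l y (a i) • pd l (f ∘ e.symm) y := by
    intro i
    have := h.decompose hy (a i)
    rwa [real_inner_comm, hinner, h.coframe_normal hy, zero_smul, add_zero] at this
  -- Pairing the expansion of the i-th Riesz vector with ∂_j f gives δⁱ_j, so its coefficients form
  -- a left inverse of the Gram matrix.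
  have hinv : (inducedMetric f e y)⁻¹ = Matrix.of fun i l => coframe f N e l y (a i) := by
    refine Matrix.inv_eq_left_inv ?_
    ext i j
    rw [← h.coframe_param hy i j, ← hinner, hdec i, sum_inner]
    simp [Matrix.mul_apply, inducedMetric, real_inner_smul_left]
  rw [hinv]
  exact hdec i

theorem coframe_apply (h : IsRegularChart f N e) (hy : y ∈ e.target) (i : Fin n)
    (w : EuclideanSpace ℝ (Fin (n + 1))) :
    coframe f N e i y w
      = ∑ l, (inducedMetric f e y)⁻¹ i l * inner ℝ (pd l (f ∘ e.symm) y) w := by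
  have h1 : inner ℝ ((InnerProductSpace.toDual ℝ _).symm (coframe f N e i y)) w
    = coframe f N e i y w := InnerProductSpace.toDual_symm_apply
  rw [← h1, h.inverse_inducedMetric hy, sum_inner]
  simp [real_inner_smul_left]

/-- The trace of a bilinear map in a frame adapted to the hypersurface. -/
theorem sum_basis_eq (h : IsRegularChart f N e) (hy : y ∈ e.target)
    {F : Type*} [NormedAddCommGroup F] [NormedSpace ℝ F]
    (B : EuclideanSpace ℝ (Fin (n + 1)) →L[ℝ] EuclideanSpace ℝ (Fin (n + 1)) →L[ℝ] F) :
    ∑ a, B (EuclideanSpace.single a 1) (EuclideanSpace.single a 1)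
      = B ((N ∘ e.symm) y) ((N ∘ e.symm) y)
        + ∑ j, ∑ k, (inducedMetric f e y)⁻¹ j k •
            B (pd j (f ∘ e.symm) y) (pd k (f ∘ e.symm) y) := by
  have hB : ∀ v w, ∑ a, (inner ℝ v (EuclideanSpace.single a 1) : ℝ) •
      B w (EuclideanSpace.single a 1) = B w v := fun v w => by
    rw [clm_apply_eq_sum (B w) v]
    simp [EuclideanSpace.inner_single_right]
  have hco : ∀ j w, ∑ a, coframe f N e j y (EuclideanSpace.single a 1) •
      B w (EuclideanSpace.single a 1)
      = ∑ k, (inducedMetric f e y)⁻¹ j k • B w (pd k (f ∘ e.symm) y) := fun j w => by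
    simp_rw [← hB (pd _ (f ∘ e.symm) y) w, h.coframe_apply hy j, Finset.sum_smul,
      Finset.smul_sum, mul_smul]
    exact Finset.sum_comm
  calc _ = ∑ a, (∑ l, coframe f N e l y (EuclideanSpace.single a 1) •
          B (pd l (f ∘ e.symm) y) (EuclideanSpace.single a 1)
        + (inner ℝ ((N ∘ e.symm) y) (EuclideanSpace.single a 1) : ℝ) •
          B ((N ∘ e.symm) y) (EuclideanSpace.single a 1)) := by
        refine Finset.sum_congr rfl fun a _ => ?_
        have := congrArg (fun v => B v (EuclideanSpace.single a 1))
          (h.decompose hy (EuclideanSpace.single a 1))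
        simpa using this
    _ = _ := by
        rw [Finset.sum_add_distrib, hB, Finset.sum_comm, add_comm]
        simp_rw [hco]

end IsRegularChart
end Hypersurface

/-! ### Calculus of coordinate partial derivatives. -/

namespace Hypersurface

section PartialDerivatives

variable {n : ℕ} {F : Type*} [NormedAddCommGroup F] [NormedSpace ℝ F]
  {y : EuclideanSpace ℝ (Fin n)}

theorem pd_congr {u v : EuclideanSpace ℝ (Fin n) → F} (h : u =ᶠ[nhds y] v) (k : Fin n) :
    pd k u y = pd k v y := by
  rw [pd, pd, h.fderiv_eq]

theorem contDiffAt_pd {a b : ℕ∞ω} {u : EuclideanSpace ℝ (Fin n) → F} (hu : ContDiffAt ℝ b u y)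
    (hab : a + 1 ≤ b) (k : Fin n) : ContDiffAt ℝ a (pd k u) y :=
  (hu.fderiv_right hab).clm_apply contDiffAt_const

theorem pd_pd_eq {u : EuclideanSpace ℝ (Fin n) → F} (hu : ContDiffAt ℝ 2 u y) (j k : Fin n) :
    pd j (pd k u) y = fderiv ℝ (fderiv ℝ u) y (EuclideanSpace.single j 1)
      (EuclideanSpace.single k 1) := by
  have h1 : DifferentiableAt ℝ (fderiv ℝ u) y :=
    (hu.fderiv_right (m := 1) (by norm_num)).differentiableAt (by simp)
  have : pd k u = fun z => fderiv ℝ u z (EuclideanSpace.single k 1) := rfl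
  rw [this, pd, fderiv_clm_apply h1 (differentiableAt_const _)]
  simp

theorem pd_comm {u : EuclideanSpace ℝ (Fin n) → F} (hu : ContDiffAt ℝ 2 u y) (j k : Fin n) :
    pd j (pd k u) y = pd k (pd j u) y := by
  rw [pd_pd_eq hu, pd_pd_eq hu]
  exact (hu.isSymmSndFDerivAt (by simp)).eq _ _

theorem pd_clm_apply {G : Type*} [NormedAddCommGroup G] [NormedSpace ℝ G]
    {c : EuclideanSpace ℝ (Fin n) → F →L[ℝ] G} {u : EuclideanSpace ℝ (Fin n) → F}
    (hc : DifferentiableAt ℝ c y) (hu : DifferentiableAt ℝ u y) (k : Fin n) :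
    pd k (fun z => c z (u z)) y = pd k c y (u y) + c y (pd k u y) := by
  simp [pd, fderiv_clm_apply hc hu, add_comm]

theorem pd_inner {F : Type*} [NormedAddCommGroup F] [InnerProductSpace ℝ F]
    {u v : EuclideanSpace ℝ (Fin n) → F}
    (hu : DifferentiableAt ℝ u y) (hv : DifferentiableAt ℝ v y) (k : Fin n) :
    pd k (fun z => (inner ℝ (u z) (v z) : ℝ)) y
      = inner ℝ (pd k u y) (v y) + inner ℝ (u y) (pd k v y) := by
  simp [pd, fderiv_inner_apply ℝ hu hv, add_comm]

@[simp]
theorem pd_const (c : F) (k : Fin n) : pd k (fun _ : EuclideanSpace ℝ (Fin n) => c) y = 0 := by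
  simp [pd]

end PartialDerivatives

/-! ### Gauss and Weingarten formulas, covariant derivatives, Gauss equation. -/

variable {n : ℕ} {M : Type*} [TopologicalSpace M]
  {f N : M → EuclideanSpace ℝ (Fin (n + 1))}
  {e : OpenPartialHomeomorph M (EuclideanSpace ℝ (Fin n))}
  {y : EuclideanSpace ℝ (Fin n)}

theorem natCast_mul_meanCurvature (y : EuclideanSpace ℝ (Fin n)) :
    (n : ℝ) * meanCurvature f N e y = (shapeOperator f N e y).trace := by
  rcases Nat.eq_zero_or_pos n with rfl | hn
  -- For n = 0 the normalising factor 1/n is 0 by convention, and the trace is an empty sum.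
  · simp [Matrix.trace]
  · have : (n : ℝ) ≠ 0 := by positivity
    rw [meanCurvature]
    field_simp

namespace IsRegularChart

theorem contDiffAt_pd_param (h : IsRegularChart f N e) (hy : y ∈ e.target) (k : Fin n) :
    ContDiffAt ℝ ∞ (pd k (f ∘ e.symm)) y :=
  contDiffAt_pd (h.contDiffAt_param y hy) (by simp) k

theorem differentiableAt_pd_param (h : IsRegularChart f N e) (hy : y ∈ e.target) (k : Fin n) :
    DifferentiableAt ℝ (pd k (f ∘ e.symm)) y :=
  (h.contDiffAt_pd_param hy k).differentiableAt (by simp)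

theorem differentiableAt_normal (h : IsRegularChart f N e) (hy : y ∈ e.target) :
    DifferentiableAt ℝ (N ∘ e.symm) y :=
  (h.contDiffAt_normal y hy).differentiableAt (by simp)

theorem differentiableAt_coframe (h : IsRegularChart f N e) (hy : y ∈ e.target) (i : Fin n) :
    DifferentiableAt ℝ (coframe f N e i) y :=
  (h.contDiffAt_coframe hy i).differentiableAt (by simp)

theorem pd_pd_param_comm (h : IsRegularChart f N e) (hy : y ∈ e.target) (j k : Fin n) :
    pd j (pd k (f ∘ e.symm)) y = pd k (pd j (f ∘ e.symm)) y :=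
  pd_comm ((h.contDiffAt_param y hy).of_le ENat.LEInfty.out) j k

/-- Gauss formula: the Christoffel symbols are the tangential components of the second
derivatives of the parametrisation. -/
theorem christoffel_eq (h : IsRegularChart f N e) (hy : y ∈ e.target) (i j k : Fin n) :
    christoffel (inducedMetric f e) i j k y
      = coframe f N e i y (pd j (pd k (f ∘ e.symm)) y) := by
  have hg : ∀ a b c : Fin n, pd a (fun z => inducedMetric f e z b c) y
      = inner ℝ (pd a (pd b (f ∘ e.symm)) y) (pd c (f ∘ e.symm) y)
        + inner ℝ (pd b (f ∘ e.symm) y) (pd a (pd c (f ∘ e.symm)) y) := fun a b c =>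
    pd_inner (h.differentiableAt_pd_param hy b) (h.differentiableAt_pd_param hy c) a
  rw [h.coframe_apply hy, christoffel, Finset.mul_sum]
  refine Finset.sum_congr rfl fun l _ => ?_
  -- By symmetry of second derivatives, four of the six inner products cancel, leaving 2⟨∂_l f,
  -- ∂_j∂_k f⟩.
  rw [hg, hg, hg, h.pd_pd_param_comm hy j l, h.pd_pd_param_comm hy k l,
    h.pd_pd_param_comm hy k j, real_inner_comm (pd j (f ∘ e.symm) y)]
  ring

/-- Weingarten formula: `∂_j N = -Sⁱ_j ∂_i`. -/
theorem shapeOperator_eq (h : IsRegularChart f N e) (hy : y ∈ e.target) (i j : Fin n) :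
    shapeOperator f N e y i j = - coframe f N e i y (pd j (N ∘ e.symm) y) := by
  rw [h.coframe_apply hy, shapeOperator, Matrix.of_apply, ← Finset.sum_neg_distrib]
  refine Finset.sum_congr rfl fun l _ => ?_
  simp [secondFundamentalForm, real_inner_comm]

/-- Differentiating ⟨N, u⟩ = 0 moves the derivative onto N, where it pairs with the tangential
expansion of u to produce II. -/
theorem inner_normal_pd (h : IsRegularChart f N e) (hy : y ∈ e.target)
    {u : EuclideanSpace ℝ (Fin n) → EuclideanSpace ℝ (Fin (n + 1))}
    (hu : DifferentiableAt ℝ u y)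
    (htan : ∀ z ∈ e.target, inner ℝ ((N ∘ e.symm) z) (u z) = 0) (k : Fin n) :
    inner ℝ ((N ∘ e.symm) y) (pd k u y)
      = ∑ l, secondFundamentalForm f N e y k l * coframe f N e l y (u y) := by
  have h1 := pd_inner (h.differentiableAt_normal hy) hu k
  have h2 : (fun z => inner ℝ ((N ∘ e.symm) z) (u z)) =ᶠ[nhds y] fun _ => (0 : ℝ) := by
    filter_upwards [e.open_target.mem_nhds hy] with z hz using htan z hz
  rw [pd_congr h2, pd_const] at h1
  have h3 : inner ℝ (pd k (N ∘ e.symm) y) (u y)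
      = - ∑ l, secondFundamentalForm f N e y k l * coframe f N e l y (u y) := by
    conv_lhs => rw [h.decompose hy (u y), htan y hy, zero_smul, add_zero, inner_sum]
    rw [← Finset.sum_neg_distrib]
    refine Finset.sum_congr rfl fun l _ => ?_
    simp [secondFundamentalForm, inner_smul_right, mul_comm]
  linarith

theorem secondFundamentalForm_eq (h : IsRegularChart f N e) (hy : y ∈ e.target) (j k : Fin n) :
    secondFundamentalForm f N e y j k
      = inner ℝ ((N ∘ e.symm) y) (pd j (pd k (f ∘ e.symm)) y) := by
  rw [h.inner_normal_pd hy (h.differentiableAt_pd_param hy k)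
    (fun z hz => h.inner_normal_param hz k) j]
  simp [h.coframe_param hy, Matrix.one_apply]

/-- Derivative of the tangential components of an ambient vector field along the hypersurface. -/
theorem pd_coframe_apply (h : IsRegularChart f N e) (hy : y ∈ e.target)
    {w : EuclideanSpace ℝ (Fin n) → EuclideanSpace ℝ (Fin (n + 1))}
    (hw : DifferentiableAt ℝ w y) (i j : Fin n) :
    pd j (fun z => coframe f N e i z (w z)) y
      = coframe f N e i y (pd j w y)
        - ∑ l, christoffel (inducedMetric f e) i j l y * coframe f N e l y (w y)
        + shapeOperator f N e y i j * inner ℝ ((N ∘ e.symm) y) (w y) := by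
  have hθ := h.differentiableAt_coframe hy i
  -- θⁱ takes constant values on the moving frame, so the product rule trades its derivative for
  -- that of ∂_l f here and of N in `h4`; these values determine ∂_j θⁱ.
  have h1 : ∀ l, pd j (coframe f N e i) y (pd l (f ∘ e.symm) y)
      = - christoffel (inducedMetric f e) i j l y := by
    intro l
    have h2 := pd_clm_apply hθ (h.differentiableAt_pd_param hy l) j
    have h3 : (fun z => coframe f N e i z (pd l (f ∘ e.symm) z))
        =ᶠ[nhds y] fun _ => (1 : Matrix (Fin n) (Fin n) ℝ) i l := by
      filter_upwards [e.open_target.mem_nhds hy] with z hz using h.coframe_param hz i l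
    rw [pd_congr h3, pd_const, ← h.christoffel_eq hy] at h2
    linarith
  have h4 : pd j (coframe f N e i) y ((N ∘ e.symm) y) = shapeOperator f N e y i j := by
    have h2 := pd_clm_apply hθ (h.differentiableAt_normal hy) j
    have h3 : (fun z => coframe f N e i z ((N ∘ e.symm) z)) =ᶠ[nhds y] fun _ => (0 : ℝ) := by
      filter_upwards [e.open_target.mem_nhds hy] with z hz using h.coframe_normal hz i
    rw [pd_congr h3, pd_const] at h2
    rw [h.shapeOperator_eq hy]
    linarith
  rw [pd_clm_apply hθ hw]
  have h5 := congrArg (fun v => pd j (coframe f N e i) y v) (h.decompose hy (w y))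
  simp only [map_add, map_sum, map_smul, h1, h4, smul_eq_mul] at h5
  rw [h5]
  simp only [neg_mul, Finset.sum_neg_distrib, mul_comm (coframe f N e _ y (w y))]
  ring

/-- The Levi-Civita derivative is the tangential part of the flat one: the Γ terms cancel, and the
shape operator term vanishes because u is tangential. -/
theorem covDeriv_eq (h : IsRegularChart f N e) (hy : y ∈ e.target)
    {u : EuclideanSpace ℝ (Fin n) → EuclideanSpace ℝ (Fin (n + 1))}
    {Y : EuclideanSpace ℝ (Fin n) → EuclideanSpace ℝ (Fin n)}
    (hu : DifferentiableAt ℝ u y)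
    (htan : inner ℝ ((N ∘ e.symm) y) (u y) = 0)
    (hY : ∀ z i, Y z i = coframe f N e i z (u z)) (k i : Fin n) :
    covDeriv (inducedMetric f e) Y k i y = coframe f N e i y (pd k u y) := by
  rw [covDeriv]
  simp only [hY]
  rw [h.pd_coframe_apply hy hu, htan]
  ring

/-- The first derivative ∂_k u is no longer tangential. Its normal component II_{kl} Yˡ is what
makes the shape operator appear. -/
theorem covDeriv₂_eq (h : IsRegularChart f N e) (hy : y ∈ e.target)
    {u : EuclideanSpace ℝ (Fin n) → EuclideanSpace ℝ (Fin (n + 1))}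
    {Y : EuclideanSpace ℝ (Fin n) → EuclideanSpace ℝ (Fin n)}
    (hu : ∀ z ∈ e.target, ContDiffAt ℝ 2 u z)
    (htan : ∀ z ∈ e.target, inner ℝ ((N ∘ e.symm) z) (u z) = 0)
    (hY : ∀ z i, Y z i = coframe f N e i z (u z)) (j k i : Fin n) :
    covDeriv₂ (inducedMetric f e) Y j k i y
      = coframe f N e i y (pd j (pd k u) y)
        + shapeOperator f N e y i j * ∑ l, secondFundamentalForm f N e y k l * Y y l
        - ∑ l, christoffel (inducedMetric f e) l j k y * coframe f N e i y (pd l u y) := by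
  have hd : ∀ z ∈ e.target, DifferentiableAt ℝ u z := fun z hz =>
    (hu z hz).differentiableAt (by simp)
  have h1 : covDeriv (inducedMetric f e) Y k i =ᶠ[nhds y]
      fun z => coframe f N e i z (pd k u z) := by
    filter_upwards [e.open_target.mem_nhds hy] with z hz using
      h.covDeriv_eq hz (hd z hz) (htan z hz) hY k i
  have h2 : DifferentiableAt ℝ (pd k u) y :=
    (contDiffAt_pd (a := 1) (hu y hy) (by norm_num) k).differentiableAt (by simp)
  rw [covDeriv₂, pd_congr h1, h.pd_coframe_apply hy h2, h.inner_normal_pd hy (hd y hy) htan]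
  simp only [h.covDeriv_eq hy (hd y hy) (htan y hy) hY, hY]
  ring

/-- Gauss equation. -/
theorem riemann_eq (h : IsRegularChart f N e) (hy : y ∈ e.target) (l k i j : Fin n) :
    riemann (inducedMetric f e) l k i j y
      = shapeOperator f N e y l i * secondFundamentalForm f N e y j k
        - shapeOperator f N e y l j * secondFundamentalForm f N e y i k := by
  have h1 : ∀ a b, pd a (christoffel (inducedMetric f e) l b k) y
      = coframe f N e l y (pd a (pd b (pd k (f ∘ e.symm))) y)
        - ∑ m, christoffel (inducedMetric f e) l a m y * christoffel (inducedMetric f e) m b k y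
        + shapeOperator f N e y l a * secondFundamentalForm f N e y b k := by
    intro a b
    have h2 : christoffel (inducedMetric f e) l b k =ᶠ[nhds y]
        fun z => coframe f N e l z (pd b (pd k (f ∘ e.symm)) z) := by
      filter_upwards [e.open_target.mem_nhds hy] with z hz using h.christoffel_eq hz l b k
    have h3 : DifferentiableAt ℝ (pd b (pd k (f ∘ e.symm))) y :=
      (contDiffAt_pd (a := ∞) (h.contDiffAt_pd_param hy k) (by simp) b).differentiableAt (by simp)
    rw [pd_congr h2, h.pd_coframe_apply hy h3, h.secondFundamentalForm_eq hy]
    simp only [h.christoffel_eq hy _ b k]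
  -- The third derivatives of f cancel by symmetry and the ΓΓ sums cancel those in the curvature,
  -- leaving only the S · II terms.
  rw [riemann, h1, h1, Finset.sum_sub_distrib,
    pd_comm ((h.contDiffAt_pd_param hy k).of_le ENat.LEInfty.out) i j]
  ring

theorem ricciEnd_eq (h : IsRegularChart f N e) (hy : y ∈ e.target) :
    ((n : ℝ) * meanCurvature f N e y) • shapeOperator f N e y - shapeOperator f N e y ^ 2
      = ricciEnd (inducedMetric f e) y := by
  ext a j
  have h1 : ricciEnd (inducedMetric f e) y a j
      = ∑ k, ∑ i, (inducedMetric f e y)⁻¹ a k *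
        (shapeOperator f N e y i i * secondFundamentalForm f N e y j k
          - shapeOperator f N e y i j * secondFundamentalForm f N e y i k) := by
    simp only [ricciEnd, Matrix.mul_apply, ricci, Matrix.of_apply, h.riemann_eq hy, Finset.mul_sum]
  have h2 : ∀ i, shapeOperator f N e y a i
      = ∑ k, (inducedMetric f e y)⁻¹ a k * secondFundamentalForm f N e y i k := fun i => rfl
  rw [natCast_mul_meanCurvature, h1, Finset.sum_comm, pow_two, Matrix.sub_apply,
    Matrix.smul_apply, Matrix.mul_apply, Matrix.trace, smul_eq_mul, Finset.sum_mul,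
    ← Finset.sum_sub_distrib]
  refine Finset.sum_congr rfl fun i _ => ?_
  rw [h2 j, h2 i, Matrix.diag_apply, Finset.mul_sum, Finset.sum_mul, ← Finset.sum_sub_distrib]
  refine Finset.sum_congr rfl fun k _ => ?_
  ring

end IsRegularChart
end Hypersurface

/-! ### Second derivatives of the ambient field along the normal line and along M. -/

namespace Hypersurface

theorem ambientBochner_eq {m : ℕ}
    {U : EuclideanSpace ℝ (Fin m) → EuclideanSpace ℝ (Fin m)} {p : EuclideanSpace ℝ (Fin m)}
    (hU : ContDiffAt ℝ 2 U p) :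
    ambientBochner U p = ∑ a, fderiv ℝ (fderiv ℝ U) p (EuclideanSpace.single a 1)
      (EuclideanSpace.single a 1) := by
  refine Finset.sum_congr rfl fun a _ => ?_
  rw [← pd_pd_eq hU]
  have h1 : flatConn (flatConn (fun _ => EuclideanSpace.single a 1)
      (fun _ => EuclideanSpace.single a 1)) U p = 0 := by
    simp [flatConn]
  rw [h1, sub_zero]
  rfl

/-- Leibniz rule at r = 0, where the factor r vanishes; the 2 here becomes the coefficient of 2S in
the radial term. -/
theorem deriv_sub_mul_id {a b : ℝ → ℝ} (ha : ContDiffAt ℝ 2 a 0) (hb : ContDiffAt ℝ 2 b 0) :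
    deriv (fun r => a r - r * b r) 0 = deriv a 0 - b 0 ∧
    deriv (deriv fun r => a r - r * b r) 0 = deriv (deriv a) 0 - 2 * deriv b 0 := by
  have hd : ∀ {c : ℝ → ℝ}, ContDiffAt ℝ 2 c 0 → ∀ᶠ r in nhds (0 : ℝ), DifferentiableAt ℝ c r :=
    fun hc => (hc.eventually (by simp)).mono fun r hr => hr.differentiableAt (by simp)
  have hd' : ∀ {c : ℝ → ℝ}, ContDiffAt ℝ 2 c 0 → DifferentiableAt ℝ (deriv c) 0 := fun hc =>
    ((hc.fderiv_right (m := 1) (by norm_num)).clm_apply contDiffAt_const).differentiableAt (by simp)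
  have h1 : ∀ᶠ r in nhds (0 : ℝ),
      deriv (fun r => a r - r * b r) r = deriv a r - (b r + r * deriv b r) := by
    filter_upwards [hd ha, hd hb] with r har hbr
    have := har.hasDerivAt.sub ((hasDerivAt_id r).mul hbr.hasDerivAt)
    simp only [id, one_mul] at this
    exact this.deriv
  refine ⟨by simpa using h1.self_of_nhds, ?_⟩
  have h2 : deriv (fun r => a r - r * b r) =ᶠ[nhds 0]
    fun r => deriv a r - (b r + r * deriv b r) := h1
  rw [h2.deriv_eq]
  have := ((hd' ha).hasDerivAt.sub ((hd hb).self_of_nhds.hasDerivAt.add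
    ((hasDerivAt_id (0 : ℝ)).mul (hd' hb).hasDerivAt))).deriv
  simp only [id, one_mul, zero_mul, add_zero] at this
  refine Eq.trans ?_ (this.trans (by ring))
  rfl

theorem deriv_clm_comp_line {F G : Type*} [NormedAddCommGroup F] [NormedSpace ℝ F]
    [NormedAddCommGroup G] [NormedSpace ℝ G] {U : F → G} {p : F} (hU : ContDiffAt ℝ 2 U p)
    (c : G →L[ℝ] ℝ) (v : F) :
    deriv (fun r : ℝ => c (U (p + r • v))) 0 = c (fderiv ℝ U p v) ∧
    deriv (deriv fun r : ℝ => c (U (p + r • v))) 0 = c (fderiv ℝ (fderiv ℝ U) p v v) := by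
  have hl : ∀ r : ℝ, HasDerivAt (fun r : ℝ => p + r • v) v r := fun r => by
    simpa using ((hasDerivAt_id r).smul_const v).const_add p
  have hc : Filter.Tendsto (fun r : ℝ => p + r • v) (nhds 0) (nhds p) := by
    simpa [ContinuousAt] using (hl 0).continuousAt
  have h1 : (deriv fun r : ℝ => c (U (p + r • v)))
      =ᶠ[nhds 0] fun r => c (fderiv ℝ U (p + r • v) v) := by
    filter_upwards [hc.eventually (hU.eventually (by simp))] with r hr
    have h2 : HasDerivAt (fun r : ℝ => U (p + r • v)) (fderiv ℝ U (p + r • v) v) r :=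
      (hr.differentiableAt (by simp)).hasFDerivAt.comp_hasDerivAt r (hl r)
    have h3 : HasDerivAt (fun r : ℝ => c (U (p + r • v))) (c (fderiv ℝ U (p + r • v) v)) r :=
      c.hasFDerivAt.comp_hasDerivAt r h2
    exact h3.deriv
  refine ⟨by simpa using h1.self_of_nhds, ?_⟩
  rw [h1.deriv_eq]
  have h2 : HasFDerivAt (fderiv ℝ U) (fderiv ℝ (fderiv ℝ U) p) (p + (0 : ℝ) • v) := by
    rw [zero_smul, add_zero]
    exact ((hU.fderiv_right (m := 1) (by norm_num)).differentiableAt (by simp)).hasFDerivAt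
  have h3 : HasDerivAt (fun r : ℝ => fderiv ℝ U (p + r • v)) (fderiv ℝ (fderiv ℝ U) p v) 0 :=
    h2.comp_hasDerivAt (0 : ℝ) (hl 0)
  have h4 : HasDerivAt (fun r : ℝ => fderiv ℝ U (p + r • v) v) (fderiv ℝ (fderiv ℝ U) p v v) 0 := by
    simpa using h3.clm_apply (hasDerivAt_const (0 : ℝ) v)
  have h5 : HasDerivAt (fun r : ℝ => c (fderiv ℝ U (p + r • v) v))
      (c (fderiv ℝ (fderiv ℝ U) p v v)) 0 := c.hasFDerivAt.comp_hasDerivAt (0 : ℝ) h4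
  exact h5.deriv

theorem pd_pd_comp {n : ℕ} {F G : Type*} [NormedAddCommGroup F] [NormedSpace ℝ F]
    [NormedAddCommGroup G] [NormedSpace ℝ G] {U : F → G} {p : EuclideanSpace ℝ (Fin n) → F}
    {y : EuclideanSpace ℝ (Fin n)} (hU : ContDiffAt ℝ 2 U (p y)) (hp : ContDiffAt ℝ 2 p y)
    (j k : Fin n) :
    pd j (pd k (U ∘ p)) y = fderiv ℝ (fderiv ℝ U) (p y) (pd j p y) (pd k p y)
      + fderiv ℝ U (p y) (pd j (pd k p) y) := by
  have h1 : pd k (U ∘ p) =ᶠ[nhds y] fun z => fderiv ℝ U (p z) (pd k p z) := by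
    filter_upwards [hp.continuousAt.eventually (hU.eventually (by simp)),
      hp.eventually (by simp)] with z hz hz'
    rw [pd, fderiv_comp z (hz.differentiableAt (by simp)) (hz'.differentiableAt (by simp))]
    rfl
  have h2 : DifferentiableAt ℝ (fderiv ℝ U) (p y) :=
    (hU.fderiv_right (m := 1) (by norm_num)).differentiableAt (by simp)
  have h3 : DifferentiableAt ℝ p y := hp.differentiableAt (by simp)
  have h4 : DifferentiableAt ℝ (pd k p) y :=
    (contDiffAt_pd (a := 1) hp (by norm_num) k).differentiableAt (by simp)
  have h5 : pd j (fderiv ℝ U ∘ p) y = fderiv ℝ (fderiv ℝ U) (p y) (pd j p y) := by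
    rw [pd, fderiv_comp y h2 h3]
    rfl
  rw [pd_congr h1, ← h5]
  exact pd_clm_apply (c := fderiv ℝ U ∘ p) (h2.comp y h3) h4 j

/-! ### Fermi components and assembly of the decomposition. -/

namespace IsRegularChart

variable {n : ℕ} {M : Type*} [TopologicalSpace M]
  {f N : M → EuclideanSpace ℝ (Fin (n + 1))}
  {e : OpenPartialHomeomorph M (EuclideanSpace ℝ (Fin n))}
  {y : EuclideanSpace ℝ (Fin n)}
  {U : EuclideanSpace ℝ (Fin (n + 1)) → EuclideanSpace ℝ (Fin (n + 1))}

theorem contDiffAt_fermiComp (h : IsRegularChart f N e) (hy : y ∈ e.target)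
    (hU : ContDiffAt ℝ 2 U ((f ∘ e.symm) y)) (i : Fin n) :
    ContDiffAt ℝ 2 (fun r => fermiComp f N e U i r y) 0 := by
  have h1 : ContDiffAt ℝ 2 (fun r : ℝ => inFermi f N e U (r, y)) 0 :=
    ContDiffAt.comp (0 : ℝ) (h.contDiffAt_inFermi hy hU) (contDiffAt_id.prodMk contDiffAt_const)
  exact ((EuclideanSpace.proj (𝕜 := ℝ) i).comp
    (ContinuousLinearMap.snd ℝ ℝ (EuclideanSpace ℝ (Fin n)))).contDiff.contDiffAt.comp (0 : ℝ) h1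

/-- The coframe is frozen at r = 0 while U varies along the normal line. Expanding U in the Fermi
frame at height r and using ∂_j N = -Sˡ_j ∂_l f gives the factor 1 - rS. -/
theorem coframe_fermiMap (h : IsRegularChart f N e) (hy : y ∈ e.target) (i : Fin n) :
    ∀ᶠ r : ℝ in nhds 0,
      coframe f N e i y (U ((f ∘ e.symm) y + r • (N ∘ e.symm) y))
        = fermiComp f N e U i r y
          - r * ∑ j, shapeOperator f N e y i j * fermiComp f N e U j r y := by
  have hc : Filter.Tendsto (fun r : ℝ => (r, y)) (nhds 0) (nhds ((0 : ℝ), y)) :=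
    (Continuous.prodMk continuous_id continuous_const).continuousAt
  filter_upwards [hc.eventually (h.eventually_isInvertible hy)] with r hr
  have h1 := hr.self_apply_inverse (U (fermiMap f N e (r, y)))
  rw [h.fderiv_fermiMap hy, clm_apply_eq_sum (fderiv ℝ (f ∘ e.symm) y),
    clm_apply_eq_sum (fderiv ℝ (N ∘ e.symm) y)] at h1
  have h2 := congrArg (coframe f N e i y) h1
  have h3 : ∀ l, coframe f N e i y (fderiv ℝ (f ∘ e.symm) y (EuclideanSpace.single l 1))
    = (1 : Matrix (Fin n) (Fin n) ℝ) i l := h.coframe_param hy i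
  have h4 : ∀ l, coframe f N e i y (fderiv ℝ (N ∘ e.symm) y (EuclideanSpace.single l 1))
      = - shapeOperator f N e y i l := fun l => by
    rw [h.shapeOperator_eq hy, neg_neg, pd]
  simp only [map_add, map_sum, map_smul, h3, h4, h.coframe_normal hy, smul_eq_mul,
    Matrix.one_apply, mul_ite, mul_one, mul_zero, Finset.sum_ite_eq, Finset.mem_univ, if_true,
    zero_add] at h2
  have h5 : fermiMap f N e (r, y) = (f ∘ e.symm) y + r • (N ∘ e.symm) y := rfl
  rw [← h5, ← h2]
  simp only [mul_neg, Finset.sum_neg_distrib, sub_eq_add_neg, mul_comm (shapeOperator f N e y i _)]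
  rfl

theorem coframe_fderiv_normal (h : IsRegularChart f N e) (hy : y ∈ e.target)
    (hU : ContDiffAt ℝ 2 U ((f ∘ e.symm) y)) (i : Fin n) :
    coframe f N e i y (fderiv ℝ U ((f ∘ e.symm) y) ((N ∘ e.symm) y))
      = deriv (fun r => fermiComp f N e U i r y) 0
        - ∑ j, shapeOperator f N e y i j * tangentialPart f N e U y j ∧
    coframe f N e i y (fderiv ℝ (fderiv ℝ U) ((f ∘ e.symm) y) ((N ∘ e.symm) y) ((N ∘ e.symm) y))
      = iteratedDeriv 2 (fun r => fermiComp f N e U i r y) 0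
        - 2 * ∑ j, shapeOperator f N e y i j * deriv (fun r => fermiComp f N e U j r y) 0 := by
  obtain ⟨h1, h2⟩ := deriv_clm_comp_line hU (coframe f N e i y) ((N ∘ e.symm) y)
  have hS : ∀ j, ContDiffAt ℝ 2
      (fun r => shapeOperator f N e y i j * fermiComp f N e U j r y) 0 := fun j =>
    contDiffAt_const.mul (h.contDiffAt_fermiComp hy hU j)
  obtain ⟨h3, h4⟩ := deriv_sub_mul_id (h.contDiffAt_fermiComp hy hU i)
    (ContDiffAt.sum (s := Finset.univ) fun j _ => hS j)
  have h5 : _ =ᶠ[nhds (0 : ℝ)] _ := h.coframe_fermiMap (U := U) hy i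
  have h6 : deriv (fun r => ∑ j, shapeOperator f N e y i j * fermiComp f N e U j r y) 0
      = ∑ j, shapeOperator f N e y i j * deriv (fun r => fermiComp f N e U j r y) 0 := by
    rw [deriv_fun_sum fun j _ => (hS j).differentiableAt (by simp)]
    refine Finset.sum_congr rfl fun j _ => ?_
    exact deriv_const_mul _ ((h.contDiffAt_fermiComp hy hU j).differentiableAt (by simp))
  rw [← h1, ← h2, h5.deriv_eq, h5.deriv.deriv_eq, h3, h4, h6, iteratedDeriv_succ, iteratedDeriv_one]
  exact ⟨rfl, rfl⟩

/-- The inner contraction g^{jk} II_{kl} is Sʲ_l only after II is known to be symmetric, since the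
definition of S contracts the other index of II. -/
theorem sum_inverse_mul_shapeOperator_mul (h : IsRegularChart f N e) (hy : y ∈ e.target)
    (i : Fin n) (Y : EuclideanSpace ℝ (Fin n)) :
    ∑ j, ∑ k, (inducedMetric f e y)⁻¹ j k *
        (shapeOperator f N e y i j * ∑ l, secondFundamentalForm f N e y k l * Y l)
      = ∑ l, (shapeOperator f N e y ^ 2) i l * Y l := by
  have hII : ∀ k l, secondFundamentalForm f N e y k l = secondFundamentalForm f N e y l k :=
    fun k l => by
      rw [h.secondFundamentalForm_eq hy, h.pd_pd_param_comm hy, ← h.secondFundamentalForm_eq hy]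
  have hS : ∀ j l, shapeOperator f N e y j l
      = ∑ k, (inducedMetric f e y)⁻¹ j k * secondFundamentalForm f N e y k l := fun j l => by
    simp only [hII _ l]
    rfl
  have hM : ∀ l, (shapeOperator f N e y ^ 2) i l = ∑ j, ∑ k, shapeOperator f N e y i j *
      ((inducedMetric f e y)⁻¹ j k * secondFundamentalForm f N e y k l) := fun l => by
    rw [pow_two, Matrix.mul_apply]
    exact Finset.sum_congr rfl fun j _ => by rw [hS j l, Finset.mul_sum]
  simp only [hM, Finset.mul_sum, Finset.sum_mul]
  symm
  rw [Finset.sum_comm]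
  refine Finset.sum_congr rfl fun j _ => ?_
  rw [Finset.sum_comm]
  refine Finset.sum_congr rfl fun k _ => Finset.sum_congr rfl fun l _ => ?_
  ring

theorem fermiComp_ambientBochner (h : IsRegularChart f N e) (hy : y ∈ e.target)
    (hU : ∀ z ∈ e.target, ContDiffAt ℝ 2 U ((f ∘ e.symm) z))
    (htan : ∀ z ∈ e.target, inner ℝ ((N ∘ e.symm) z) (U ((f ∘ e.symm) z)) = 0) (i : Fin n) :
    fermiComp f N e (ambientBochner U) i 0 y
      = bochner (inducedMetric f e) (tangentialPart f N e U) y i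
        + ∑ l, (((n : ℝ) * meanCurvature f N e y) • shapeOperator f N e y
            - shapeOperator f N e y ^ 2) i l * tangentialPart f N e U y l
        + radialTerm f N e U y i := by
  have hp : ∀ z ∈ e.target, ContDiffAt ℝ 2 (f ∘ e.symm) z := fun z hz =>
    (h.contDiffAt_param z hz).of_le ENat.LEInfty.out
  have hu : ∀ z ∈ e.target, ContDiffAt ℝ 2 (U ∘ (f ∘ e.symm)) z := fun z hz =>
    (hU z hz).comp z (hp z hz)
  have h1 : bochner (inducedMetric f e) (tangentialPart f N e U) y i
      = ∑ j, ∑ k, (inducedMetric f e y)⁻¹ j k *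
          (coframe f N e i y (fderiv ℝ (fderiv ℝ U) ((f ∘ e.symm) y)
              (pd j (f ∘ e.symm) y) (pd k (f ∘ e.symm) y))
            + secondFundamentalForm f N e y j k
              * coframe f N e i y (fderiv ℝ U ((f ∘ e.symm) y) ((N ∘ e.symm) y))
            + shapeOperator f N e y i j *
              ∑ l, secondFundamentalForm f N e y k l * tangentialPart f N e U y l) := by
    refine Finset.sum_congr rfl fun j _ => Finset.sum_congr rfl fun k _ => ?_
    rw [h.covDeriv₂_eq hy hu htan (fun z i => tangentialPart_apply U z i),
      pd_pd_comp (hU y hy) (hp y hy)]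
    -- In the splitting of ∂_j∂_k f, the Γ part cancels the last connection term of ∇_j∇_k, and the
    -- II part leaves the normal derivative of U.
    have h2 := congrArg (fun v => coframe f N e i y (fderiv ℝ U ((f ∘ e.symm) y) v))
      (h.decompose hy (pd j (pd k (f ∘ e.symm)) y))
    have h3 : ∀ l, pd l (U ∘ (f ∘ e.symm)) y
        = fderiv ℝ U ((f ∘ e.symm) y) (pd l (f ∘ e.symm) y) := fun l => by
      rw [pd, fderiv_comp y ((hU y hy).differentiableAt (by simp))
        ((hp y hy).differentiableAt (by simp))]
      rfl
    simp only [map_add, map_sum, map_smul, smul_eq_mul, ← h.christoffel_eq hy, ← h3,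
      ← h.secondFundamentalForm_eq hy] at h2
    rw [map_add, h2]
    ring
  obtain ⟨h4, h5⟩ := h.coframe_fderiv_normal hy (hU y hy) i
  have h6 : ∑ j, ∑ k, (inducedMetric f e y)⁻¹ j k * secondFundamentalForm f N e y j k
      = (shapeOperator f N e y).trace := rfl
  have h7 := h.sum_inverse_mul_shapeOperator_mul hy i (tangentialPart f N e U y)
  simp only [mul_add, Finset.sum_add_distrib, h7] at h1
  simp only [← mul_assoc, ← Finset.sum_mul, h6] at h1
  rw [fermiComp_zero, ambientBochner_eq (hU y hy), h.sum_basis_eq hy]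
  simp only [map_add, map_sum, map_smul, smul_eq_mul]
  rw [h5, h1, h4, radialTerm, natCast_mul_meanCurvature]
  simp only [Matrix.sub_apply, Matrix.add_apply, Matrix.smul_apply, smul_eq_mul, sub_mul, add_mul,
    Finset.sum_sub_distrib, Finset.sum_add_distrib, mul_assoc, ← Finset.mul_sum]
  simp only [Matrix.one_apply, ite_mul, one_mul, zero_mul, Finset.sum_ite_eq, Finset.mem_univ,
    if_true]
  ring

end IsRegularChart
end Hypersurface

theorem mainTheorem1 {n : ℕ}
    {M : Type*} [TopologicalSpace M] [ChartedSpace (EuclideanSpace ℝ (Fin n)) M]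
    [IsManifold (𝓡 n) ∞ M]
    (f : M → EuclideanSpace ℝ (Fin (n + 1)))
    (hf : Manifold.IsSmoothEmbedding (𝓡 n) (𝓡 (n + 1)) ∞ f)
    (N : M → EuclideanSpace ℝ (Fin (n + 1)))
    (hN : Hypersurface.IsUnitNormal f N)
    (W : Set (EuclideanSpace ℝ (Fin (n + 1)))) (hW : IsOpen W) (hfW : Set.range f ⊆ W)
    (U : EuclideanSpace ℝ (Fin (n + 1)) → EuclideanSpace ℝ (Fin (n + 1)))
    (hU : ContDiffOn ℝ 2 U W)
    (hUtan : ∀ p : M, inner ℝ (U (f p)) (N p) = 0)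
    (e : OpenPartialHomeomorph M (EuclideanSpace ℝ (Fin n)))
    (he : e ∈ IsManifold.maximalAtlas (𝓡 n) ∞ M)
    (x : EuclideanSpace ℝ (Fin n)) (hx : x ∈ e.target) :
    -- Fermi coordinates are regular near `(0, x)`, and `U` is twice differentiable in them
    (∀ᶠ q in nhds ((0 : ℝ), x), (fderiv ℝ (Hypersurface.fermiMap f N e) q).IsInvertible) ∧
    ContDiffAt ℝ 2 (Hypersurface.inFermi f N e U) (0, x) ∧
    -- decomposition before the Gauss equation
    (∀ i : Fin n,
      Hypersurface.fermiComp f N e (Hypersurface.ambientBochner U) i 0 x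
        = Hypersurface.bochner (Hypersurface.inducedMetric f e)
              (Hypersurface.tangentialPart f N e U) x i
          + ∑ l, (((n : ℝ) * Hypersurface.meanCurvature f N e x)
                • Hypersurface.shapeOperator f N e x
              - Hypersurface.shapeOperator f N e x ^ 2) i l
            * Hypersurface.tangentialPart f N e U x l
          + Hypersurface.radialTerm f N e U x i) ∧
    -- the extrinsic zeroth-order terms are the intrinsic Ricci curvature
    ((n : ℝ) * Hypersurface.meanCurvature f N e x) • Hypersurface.shapeOperator f N e x
        - Hypersurface.shapeOperator f N e x ^ 2
      = Hypersurface.ricciEnd (Hypersurface.inducedMetric f e) x ∧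
    -- the decomposition
    (∀ i : Fin n,
      Hypersurface.fermiComp f N e (Hypersurface.ambientBochner U) i 0 x
        = Hypersurface.deformationLaplacian (Hypersurface.inducedMetric f e)
              (Hypersurface.tangentialPart f N e U) x i
          + Hypersurface.radialTerm f N e U x i) := by
  have h := Hypersurface.isRegularChart hf hN he
  have hU' : ∀ z ∈ e.target, ContDiffAt ℝ 2 U ((f ∘ e.symm) z) := fun z _ =>
    hU.contDiffAt (hW.mem_nhds (hfW ⟨_, rfl⟩))
  have h1 := h.fermiComp_ambientBochner hx hU' fun z _ => by
    rw [real_inner_comm]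
    exact hUtan _
  have h2 := h.ricciEnd_eq hx
  refine ⟨h.eventually_isInvertible hx, h.contDiffAt_inFermi hx (hU' x hx), h1, h2, fun i => ?_⟩
  rw [h1, h2, Hypersurface.deformationLaplacian]
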